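/- All function spaces carry the topology of pointwise convergence, i.e. sets of functions $X\to Y$ are regarded as subspaces of the Tychonoff product $Y^X$. For topological spaces $X,Y$, let $B_0(X,Y)$ be the set of continuous functions $X\to Y$; for a countable ordinal $\alpha>0$ let $B_\alpha(X,Y)$ be the set of pointwise limits of sequences from $\bigcup_{\beta<\alpha}B_\beta(X,Y)$; and let $B(X,Y)=\bigcup_{\alpha<\omega_1}B_\alpha(X,Y)$. Let $B_1^{st}(X,Y)$ be the set of all $f:X\to Y$ for which there are continuous functions $f_n:X\to Y$, $n\in\mathbb N$, such that for every $x\in X$ the set $\{n: f_n(x)\neq f(x)\}$ is finite. The space $X$ is called $Y$-Tychonoff if for every closed $A\subseteq X$, every $y_0\in Y$ and every function $f:F\to Y$ on a finite set $F\subseteq X\setminus A$ there is a continuous $\bar f:X\to Y$ with $\bar f|_F=f$ and $\bar f(A)\subseteq\{y_0\}$. Let $X_{\aleph_0}$ be the set $X$ with the Baire topology, which has the zero-sets of continuous functions $X\to\mathbb R$ as a basis. A topological space $Z$ has property $\gamma$ if every family $\mathcal U$ of open sets such that each finite subset of $Z$ lies in a member of $\mathcal U$ contains a sequence $(U_n)_{n\in\mathbb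 N}$ (repetitions allowed) with $\bigcup_n\bigcap_{i\ge n}U_i=Z$. **Theorem.** Let $Y$ be a non-compact metrizable space, let $X$ be a $Y$-Tychonoff space, and let $H$ be a subspace of $B(X,Y)$ containing $B_1^{st}(X,Y)$. Then the following are equivalent: (i) $H$ is a Fréchet–Urysohn space; (ii) $H$ is a sequential space; (iii) $H$ is a $k$-space, i.e. for each non-closed $A\subseteq H$ there is a compact $K\subseteq H$ such that $A\cap K$ is not closed in $K$; (iv) $H$ has countable tightness, i.e. every point of the closure of a set $A\subseteq H$ lies in the closure of a countable subset of $A$; (v) $X_{\aleph_0}$ has property $\gamma$. **Corollary.** Let $X$ be a Tychonoff space and let $H$ be a subspace of $B(X,\mathbb R)$ containing $B_1^{st}(X,\mathbb R)$. Then (i)–(v) are equivalent. -/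

import Mathlib

open Set Filter Topology

namespace BaireSpaces

/-- `X` is `Y`-Tychonoff: for every closed `A ⊆ X`, every point `y₀ : Y` and every function
`f : F → Y` on a finite set `F ⊆ X \ A` there is a continuous function `X → Y` which extends `f`
and maps `A` into `{y₀}`. -/
def IsTychonoffFor (X Y : Type*) [TopologicalSpace X] [TopologicalSpace Y] : Prop :=
  ∀ (A : Set X) (y₀ : Y) (F : Set X) (f : F → Y), IsClosed A → F.Finite → Disjoint F A →
    ∃ g : X → Y, Continuous g ∧ (∀ x : F, g x = f x) ∧ ∀ x ∈ A, g x = y₀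

/-- `IsBaireOfClass α f`: the function `f : X → Y` belongs to the Baire class `B_α(X, Y)`. The class
`B_0` consists of the continuous functions, and for `α ≠ 0` the class `B_α` consists of the
pointwise limits of sequences from `⋃ β < α, B_β`. -/
inductive IsBaireOfClass {X Y : Type*} [TopologicalSpace X] [TopologicalSpace Y] :
    Ordinal.{0} → (X → Y) → Prop
  | continuous (f : X → Y) (hf : Continuous f) : IsBaireOfClass 0 f
  | limit (α : Ordinal.{0}) (f : X → Y) (β : ℕ → Ordinal.{0}) (u : ℕ → X → Y) (hα : α ≠ 0)
      (hβ : ∀ n, β n < α) (hu : ∀ n, IsBaireOfClass (β n) (u n))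
      (hlim : ∀ x, Tendsto (fun n => u n x) atTop (𝓝 (f x))) : IsBaireOfClass α f

/-- `B(X, Y)`, the set of all Baire functions: the union of the Baire classes `B_α(X, Y)` over all
countable ordinals `α`. -/
def baireFunctions (X Y : Type*) [TopologicalSpace X] [TopologicalSpace Y] : Set (X → Y) :=
  {f | ∃ α : Ordinal.{0}, α < Ordinal.omega 1 ∧ IsBaireOfClass α f}

/-- `B_1^{st}(X, Y)`, the stable first Baire class: the limits of stably convergent sequences of
continuous functions. -/
def stableBaireOne (X Y : Type*) [TopologicalSpace X] [TopologicalSpace Y] : Set (X → Y) :=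
  {f | ∃ u : ℕ → X → Y, (∀ n, Continuous (u n)) ∧ ∀ x, {n | u n x ≠ f x}.Finite}

/-- The zero-sets of continuous real-valued functions. -/
def zeroSets (X : Type*) [TopologicalSpace X] : Set (Set X) :=
  {Z | ∃ f : X → ℝ, Continuous f ∧ Z = f ⁻¹' {0}}

/-- The space `X_{ℵ₀}`: the underlying set of `X` with the Baire topology. -/
def WithBaireTopology (X : Type*) [TopologicalSpace X] : Type _ := X

/-- The Baire topology is generated by the zero-sets of `X`; the zero-sets form a basis of it, see
`isTopologicalBasis_zeroSets`. -/
instance (X : Type*) [TopologicalSpace X] : TopologicalSpace (WithBaireTopology X) :=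
  TopologicalSpace.generateFrom (zeroSets X)

theorem isTopologicalBasis_zeroSets (X : Type*) [TopologicalSpace X] :
    TopologicalSpace.IsTopologicalBasis (α := WithBaireTopology X) (zeroSets X) := by
  refine ⟨?_, ?_, rfl⟩
  · rintro _ ⟨f, hf, rfl⟩ _ ⟨g, hg, rfl⟩ x hx
    refine ⟨_, ⟨fun x => |f x| + |g x|, hf.abs.add hg.abs, rfl⟩, ?_, ?_⟩
    · have h1 : f x = 0 := hx.1
      have h2 : g x = 0 := hx.2
      change |f x| + |g x| = 0
      simp [h1, h2]
    · intro y hy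
      have h : |f y| + |g y| = 0 := hy
      have h1 := abs_nonneg (f y)
      have h2 := abs_nonneg (g y)
      exact ⟨abs_eq_zero.1 (by linarith), abs_eq_zero.1 (by linarith)⟩
  · refine eq_univ_of_forall fun x => ⟨univ, ⟨fun _ => 0, continuous_const, ?_⟩, mem_univ x⟩
    exact (eq_univ_of_forall fun _ => rfl).symm

/-- `𝒰` is an `ω`-cover of `X`: every finite subset of `X` lies in a member of `𝒰`. -/
def IsOmegaCover {X : Type*} (𝒰 : Set (Set X)) : Prop :=
  ∀ F : Set X, F.Finite → ∃ U ∈ 𝒰, F ⊆ U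

/-- The property `γ`: every open `ω`-cover of `X` contains a sequence `U₀, U₁, …` (repetitions
are allowed) with `⋃ n, ⋂ i ≥ n, U i = X`. -/
def HasPropertyGamma (X : Type*) [TopologicalSpace X] : Prop :=
  ∀ 𝒰 : Set (Set X), (∀ U ∈ 𝒰, IsOpen U) → IsOmegaCover 𝒰 →
    ∃ U : ℕ → Set X, (∀ n, U n ∈ 𝒰) ∧ ⋃ n, ⋂ i ≥ n, U i = univ

/-- Countable tightness: every point of the closure of a set `A` lies in the closure of a countable
subset of `A`. -/
def HasCountableTightness (X : Type*) [TopologicalSpace X] : Prop :=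
  ∀ (A : Set X) (x : X), x ∈ closure A → ∃ C ⊆ A, C.Countable ∧ x ∈ closure C

/-- The class `CompactlyCoherentSpace` is the notion of a `k`-space: for each non-closed set `A`
there is a compact set `K` such that `A ∩ K` is not closed in `K`. -/
theorem compactlyCoherentSpace_iff (X : Type*) [TopologicalSpace X] :
    CompactlyCoherentSpace X ↔ ∀ A : Set X, ¬ IsClosed A →
      ∃ K : Set X, IsCompact K ∧ ¬ IsClosed ((fun x : K => (x : X)) ⁻¹' A) := by
  constructor
  · intro h A hA
    by_contra hc
    push Not at hc
    exact hA ((CompactlyCoherentSpace.isClosed_iff A).2 hc)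
  · intro h
    refine CompactlyCoherentSpace.of_isClosed fun A hA => ?_
    by_contra hc
    obtain ⟨K, hK, hn⟩ := h A hc
    exact hn (hA K hK)

end BaireSpaces

namespace BaireSpaces

/-! Everything is transferred to Z = X_{ℵ₀}. It is a T1 `P`-space, every Baire function is locally
constant on it, and the stable first Baire class supplies two-valued functions separating finite
sets from complements of their open neighbourhoods (`IsTychonoffFor.exists_mem_stableBaireOne`).
Only these facts about Z and H are used afterwards.

Property `γ` makes H Fréchet–Urysohn, since approximation of a locally constant function on finite
sets gives an open `ω`-cover. Conversely, a Lindelöf `P`-space has property `γ`, so countable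
tightness and the `k`-property need only yield that Z is Lindelöf.

For an open cover and values a ≠ b, let A be the functions into {a, b} whose a-level set is
countably covered. The constant a lies in the closure of A, and A contains the closure of each of
its countable subsets; tightness then gives a countable subcover. If H is a `k`-space and there is
no such subcover, a compact set witnessing that A is not closed yields points and functions indexed
by ω₁ with f_j(x_i) = a exactly when i ≤ j. A cluster point of the f_j shows that the x_i form an
uncountable locally countable set, which `SeparatesFinite.countable_of_locally_countable` forbids;
non-compactness of Y does its work there. -/

/-- A `P`-space: countable intersections of open sets are open. -/
def IsPSpace (Z : Type*) [TopologicalSpace Z] : Prop :=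
  ∀ s : ℕ → Set Z, (∀ n, IsOpen (s n)) → IsOpen (⋂ n, s n)

/-! ### Lindelöf `P`-spaces and `ω`-covers -/

section PSpace

variable {Z : Type*} [TopologicalSpace Z]

theorem IsPSpace.isOpen_biInter (hP : IsPSpace Z) {ι : Type*} {I : Set ι} (hI : I.Countable)
    {s : ι → Set Z} (hs : ∀ i ∈ I, IsOpen (s i)) : IsOpen (⋂ i ∈ I, s i) := by
  rcases I.eq_empty_or_nonempty with rfl | hne
  · simp
  · obtain ⟨e, rfl⟩ := hI.exists_eq_range hne
    rw [biInter_range]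
    exact hP _ fun n => hs _ (mem_range_self n)

theorem IsPSpace.isClosed_of_countable [T1Space Z] (hP : IsPSpace Z) {C : Set Z}
    (hC : C.Countable) : IsClosed C := by
  rw [← isOpen_compl_iff]
  have h : Cᶜ = ⋂ x ∈ C, ({x}ᶜ : Set Z) := by
    ext z
    simp only [mem_compl_iff, mem_iInter, mem_singleton_iff]
    exact ⟨fun h x hx hzx => h (hzx ▸ hx), fun h hz => h z hz rfl⟩
  rw [h]
  exact hP.isOpen_biInter hC fun x _ => isOpen_compl_singleton

/-- In a Lindelöf `P`-space, every open `ω`-cover contains a countable subfamily that catches all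
sets of size at most `n`. -/
theorem IsPSpace.exists_countable_of_card_le [LindelofSpace Z] (hP : IsPSpace Z) (n : ℕ) :
    ∀ 𝒰 : Set (Set Z), (∀ U ∈ 𝒰, IsOpen U) → IsOmegaCover 𝒰 →
      ∃ 𝒱 ⊆ 𝒰, 𝒱.Countable ∧ ∀ F : Finset Z, F.card ≤ n → ∃ U ∈ 𝒱, (F : Set Z) ⊆ U := by
  classical
  induction n with
  | zero =>
    intro 𝒰 _ hω
    obtain ⟨U, hU, -⟩ := hω ∅ finite_empty
    refine ⟨{U}, singleton_subset_iff.2 hU, countable_singleton U, fun F hF => ⟨U, rfl, ?_⟩⟩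
    rw [Finset.card_eq_zero.1 (Nat.le_zero.1 hF)]
    simp
  | succ n ih =>
    intro 𝒰 hopen hω
    -- The members containing x still form an `ω`-cover. The intersection of the countable family
    -- found for x is an open neighbourhood of x; if z lies in it, catching F \ {z} by that family
    -- already catches F.
    have key : ∀ x : Z, ∃ 𝒱 ⊆ {U ∈ 𝒰 | x ∈ U}, 𝒱.Countable ∧
        ∀ F : Finset Z, F.card ≤ n → ∃ U ∈ 𝒱, (F : Set Z) ⊆ U := by
      intro x
      refine ih _ (fun U hU => hopen U hU.1) fun F hF => ?_
      obtain ⟨U, hU, hFU⟩ := hω (insert x F) (hF.insert x)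
      exact ⟨U, ⟨hU, hFU (mem_insert x F)⟩, (subset_insert x F).trans hFU⟩
    choose 𝒱 hsub hcount hcov using key
    obtain ⟨T, hT, hTcov⟩ := isLindelof_univ.elim_countable_subcover
      (fun x => ⋂ U ∈ 𝒱 x, U)
      (fun x => hP.isOpen_biInter (hcount x) fun U hU => hopen U (hsub x hU).1)
      (fun x _ => mem_iUnion.2 ⟨x, mem_iInter₂.2 fun U hU => (hsub x hU).2⟩)
    obtain ⟨𝒱₀, hsub₀, hcount₀, hcov₀⟩ := ih 𝒰 hopen hω
    refine ⟨𝒱₀ ∪ ⋃ x ∈ T, 𝒱 x,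
      union_subset hsub₀ (iUnion₂_subset fun x _ => (hsub x).trans fun U hU => hU.1),
      hcount₀.union (hT.biUnion fun x _ => hcount x), fun F hF => ?_⟩
    rcases F.eq_empty_or_nonempty with rfl | ⟨z, hz⟩
    · obtain ⟨U, hU, hFU⟩ := hcov₀ ∅ (by simp)
      exact ⟨U, Or.inl hU, hFU⟩
    · obtain ⟨x, hx, hzx⟩ := mem_iUnion₂.1 (hTcov (mem_univ z))
      obtain ⟨U, hU, hFU⟩ := hcov x (F.erase z) (by
        rw [Finset.card_erase_of_mem hz]; omega)
      refine ⟨U, Or.inr (mem_iUnion₂.2 ⟨x, hx, hU⟩), fun y hy => ?_⟩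
      by_cases hyz : y = z
      · exact hyz ▸ mem_iInter₂.1 hzx U hU
      · exact hFU (Finset.mem_coe.2 (Finset.mem_erase.2 ⟨hyz, hy⟩))

/-- In a countable `ω`-subcover, the members containing x intersect in a neighbourhood of x.
Countably many of these, at points e 0, e 1, …, cover Z. If U n contains e 0, …, e n, then the
neighbourhood of e j lies in all U i with i ≥ j. -/
theorem IsPSpace.hasPropertyGamma [LindelofSpace Z] (hP : IsPSpace Z) : HasPropertyGamma Z := by
  classical
  intro 𝒰 hopen hω
  choose 𝒱 hsub hcount hcov using fun n => hP.exists_countable_of_card_le n 𝒰 hopen hω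
  have hsub' : ⋃ n, 𝒱 n ⊆ 𝒰 := iUnion_subset hsub
  have hcount' : (⋃ n, 𝒱 n).Countable := countable_iUnion hcount
  have hcov' : ∀ F : Finset Z, ∃ U ∈ ⋃ n, 𝒱 n, (F : Set Z) ⊆ U := fun F => by
    obtain ⟨U, hU, hFU⟩ := hcov F.card F le_rfl
    exact ⟨U, mem_iUnion.2 ⟨_, hU⟩, hFU⟩
  obtain ⟨T, hT, hTcov⟩ := isLindelof_univ.elim_countable_subcover
    (fun x => ⋂ U ∈ {U ∈ ⋃ n, 𝒱 n | x ∈ U}, U)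
    (fun x => hP.isOpen_biInter (hcount'.mono fun U hU => hU.1) fun U hU => hopen U (hsub' hU.1))
    (fun x _ => mem_iUnion.2 ⟨x, mem_iInter₂.2 fun U hU => hU.2⟩)
  rcases T.eq_empty_or_nonempty with rfl | hne
  · obtain ⟨U, hU, -⟩ := hω ∅ finite_empty
    refine ⟨fun _ => U, fun _ => hU, eq_univ_of_forall fun z => ?_⟩
    simpa using hTcov (mem_univ z)
  · obtain ⟨e, rfl⟩ := hT.exists_eq_range hne
    choose U hU hFU using fun n => hcov' ((Finset.range (n + 1)).image e)
    refine ⟨U, fun n => hsub' (hU n), eq_univ_of_forall fun z => ?_⟩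
    obtain ⟨_, ⟨j, rfl⟩, hz⟩ := mem_iUnion₂.1 (hTcov (mem_univ z))
    refine mem_iUnion.2 ⟨j, mem_iInter₂.2 fun i hi => mem_iInter₂.1 hz _ ⟨hU i, ?_⟩⟩
    exact hFU i (Finset.mem_coe.2
      (Finset.mem_image_of_mem e (Finset.mem_range.2 (Nat.lt_succ_of_le hi))))

/-- If `D` meets a neighbourhood of every point in a countable set, then every finite set `F` has a
neighbourhood that contains no point of `D` outside `F`. -/
theorem IsPSpace.exists_isOpen_inter_subset [T1Space Z] (hP : IsPSpace Z) {D : Set Z}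
    (hD : ∀ x, ∃ U, IsOpen U ∧ x ∈ U ∧ (U ∩ D).Countable) {F : Set Z} (hF : F.Finite) :
    ∃ U, IsOpen U ∧ F ⊆ U ∧ U ∩ D ⊆ F := by
  choose V hVo hxV hVD using hD
  refine ⟨(⋃ x ∈ F, V x) \ (((⋃ x ∈ F, V x) ∩ D) \ F), ?_, ?_, ?_⟩
  · refine (isOpen_biUnion fun x _ => hVo x).sdiff (hP.isClosed_of_countable ?_)
    refine Countable.mono sdiff_subset ?_
    rw [iUnion₂_inter]
    exact hF.countable.biUnion fun x _ => hVD x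
  · exact fun x hx => ⟨mem_iUnion₂.2 ⟨x, hx, hxV x⟩, fun h => h.2 hx⟩
  · rintro x ⟨⟨hx, hn⟩, hxD⟩
    by_contra hxF
    exact hn ⟨⟨hx, hxD⟩, hxF⟩

end PSpace

/-! ### From property `γ` to the Fréchet–Urysohn property -/

section PropertyGamma

variable {Z Y : Type*} [TopologicalSpace Z]

/-- If `Z` has the property `γ`, then a set of locally constant functions on `Z` is a
Fréchet–Urysohn space. -/
theorem HasPropertyGamma.frechetUrysohnSpace [T1Space Z] [TopologicalSpace Y]
    [TopologicalSpace.MetrizableSpace Y] (hγ : HasPropertyGamma Z) {H : Set (Z → Y)}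
    (hloc : ∀ f ∈ H, ∀ s : Set Y, IsOpen (f ⁻¹' s)) : FrechetUrysohnSpace H := by
  let _ := TopologicalSpace.metrizableSpaceMetric Y
  rcases finite_or_infinite Z with hfin | hinf
  · infer_instance
  refine ⟨fun A f hf => ?_⟩
  let e := Infinite.natEmbedding Z
  -- Removing the point e n forces the precision to improve: along a `γ`-sequence each e l
  -- eventually lies in every member, so the index l eventually stops occurring.
  let W : H → ℕ → Set Z := fun g n =>
    {x | dist ((g : Z → Y) x) ((f : Z → Y) x) < 1 / ((n : ℝ) + 1)} \ {e n}
  have hW : ∀ g n, IsOpen (W g n) := by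
    refine fun g n => IsOpen.sdiff ?_ isClosed_singleton
    refine isOpen_iff_forall_mem_open.2 fun x hx => ?_
    refine ⟨(g : Z → Y) ⁻¹' {(g : Z → Y) x} ∩ (f : Z → Y) ⁻¹' {(f : Z → Y) x}, ?_,
      (hloc _ g.2 _).inter (hloc _ f.2 _), rfl, rfl⟩
    rintro y ⟨hy1, hy2⟩
    have h1 : (g : Z → Y) y = (g : Z → Y) x := hy1
    have h2 : (f : Z → Y) y = (f : Z → Y) x := hy2
    change dist _ _ < _
    rw [h1, h2]
    exact hx
  have hω : IsOmegaCover {U | ∃ g ∈ A, ∃ n, U = W g n} := by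
    intro F hF
    obtain ⟨n, hn⟩ : ∃ n, e n ∉ F := by
      by_contra! h
      exact infinite_range_of_injective e.injective (hF.subset (range_subset_iff.2 h))
    have hN : {g : H | ∀ x ∈ F, dist ((g : Z → Y) x) ((f : Z → Y) x) < 1 / ((n : ℝ) + 1)}
        ∈ 𝓝 f := by
      have h : ∀ x ∈ F, ∀ᶠ g : H in 𝓝 f,
          dist ((g : Z → Y) x) ((f : Z → Y) x) < 1 / ((n : ℝ) + 1) := fun x _ => by
        have hc : Continuous fun g : H => (g : Z → Y) x :=
          (continuous_apply x).comp continuous_subtype_val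
        exact Metric.tendsto_nhds.1 (hc.tendsto f) _ (by positivity)
      exact (hF.eventually_all).2 h
    obtain ⟨g, hg, hgA⟩ := mem_closure_iff_nhds.1 hf _ hN
    exact ⟨_, ⟨g, hgA, n, rfl⟩, fun x hx => ⟨hg x hx, fun h => hn (h ▸ hx)⟩⟩
  obtain ⟨U, hU, hcov⟩ := hγ _ (by rintro _ ⟨g, -, n, rfl⟩; exact hW g n) hω
  choose g hgA k hk using hU
  have hev : ∀ x, ∀ᶠ i in atTop, x ∈ W (g i) (k i) := fun x => by
    obtain ⟨j, hj⟩ := mem_iUnion.1 (hcov ▸ mem_univ x)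
    filter_upwards [eventually_ge_atTop j] with i hi
    exact hk i ▸ mem_iInter₂.1 hj i hi
  have hktop : Tendsto k atTop atTop := by
    refine tendsto_atTop.2 fun m => ?_
    have h : ∀ᶠ i in atTop, ∀ l ∈ Iio m, e l ∈ W (g i) (k i) :=
      ((finite_Iio m).eventually_all).2 fun l _ => hev (e l)
    filter_upwards [h] with i hi
    by_contra! hlt
    exact (hi _ hlt).2 rfl
  refine ⟨g, hgA, tendsto_subtype_rng.2 (tendsto_pi_nhds.2 fun x => ?_)⟩
  refine tendsto_iff_dist_tendsto_zero.2 (squeeze_zero' (Eventually.of_forall fun _ => dist_nonneg)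
    ?_ ((tendsto_one_div_add_atTop_nhds_zero_nat (𝕜 := ℝ)).comp hktop))
  filter_upwards [hev x] with i hi
  exact hi.1.le

end PropertyGamma

/-! ### The Baire topology and the stable first Baire class -/

section BaireTopology

variable {X Y : Type*} [TopologicalSpace X] [TopologicalSpace Y]

theorem isPSpace_withBaireTopology : IsPSpace (WithBaireTopology X) := by
  intro s hs
  refine (isTopologicalBasis_zeroSets X).isOpen_iff.2 fun x hx => ?_
  have key : ∀ n, ∃ φ : X → ℝ, Continuous φ ∧ φ x = 0 ∧ φ ⁻¹' {0} ⊆ s n := fun n => by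
    obtain ⟨_, ⟨φ, hφ, rfl⟩, hxφ, hsub⟩ :=
      (isTopologicalBasis_zeroSets X).isOpen_iff.1 (hs n) x (mem_iInter.1 hx n)
    exact ⟨φ, hφ, hxφ, hsub⟩
  choose φ hφ hxφ hsub using key
  -- The uniformly convergent sum of these terms is continuous and vanishes exactly at the common
  -- zeros of the φ n.
  have hnn : ∀ n y, 0 ≤ (1 / 2 : ℝ) ^ n * min 1 |φ n y| := fun n y => by positivity
  have hle : ∀ n y, (1 / 2 : ℝ) ^ n * min 1 |φ n y| ≤ (1 / 2) ^ n := fun n y =>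
    mul_le_of_le_one_right (by positivity) (min_le_left _ _)
  have hsum : ∀ y, Summable fun n => (1 / 2 : ℝ) ^ n * min 1 |φ n y| := fun y =>
    Summable.of_nonneg_of_le (fun n => hnn n y) (fun n => hle n y) summable_geometric_two
  refine ⟨_, ⟨fun y => ∑' n, (1 / 2 : ℝ) ^ n * min 1 |φ n y|, ?_, rfl⟩, ?_, ?_⟩
  · refine continuous_tsum (fun n => ?_) summable_geometric_two fun n y => ?_
    · exact continuous_const.mul (continuous_const.min (hφ n).abs)
    · rw [Real.norm_of_nonneg (hnn n y)]
      exact hle n y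
  · change ∑' n, (1 / 2 : ℝ) ^ n * min 1 |φ n x| = 0
    simp [hxφ]
  · intro y hy
    refine mem_iInter.2 fun n => hsub n ?_
    have h0 : ∑' n, (1 / 2 : ℝ) ^ n * min 1 |φ n y| = 0 := hy
    have h1 : (1 / 2 : ℝ) ^ n * min 1 |φ n y| = 0 :=
      congrFun ((hasSum_zero_iff_of_nonneg fun n => hnn n y).1 (h0 ▸ (hsum y).hasSum)) n
    have h2 : min 1 |φ n y| = 0 := (mul_eq_zero.1 h1).resolve_left (by positivity)
    rcases min_choice 1 |φ n y| with h | h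
    · rw [h] at h2; exact absurd h2 one_ne_zero
    · exact abs_eq_zero.1 (h ▸ h2)

/-- Level sets are open: a pointwise limit is constant where every term of the sequence is constant,
and such a countable intersection is open in a `P`-space. -/
theorem IsBaireOfClass.isOpen_preimage [TopologicalSpace.MetrizableSpace Y] {α : Ordinal.{0}}
    {f : X → Y} (hf : IsBaireOfClass α f) (s : Set Y) :
    IsOpen (X := WithBaireTopology X) (f ⁻¹' s) := by
  induction hf generalizing s with
  | continuous f hf =>
    let _ := TopologicalSpace.metrizableSpaceMetric Y
    refine isOpen_iff_forall_mem_open.2 fun x hx => ?_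
    refine ⟨(fun y => dist (f y) (f x)) ⁻¹' {0}, fun y hy => ?_,
      (isTopologicalBasis_zeroSets X).isOpen ⟨_, hf.dist continuous_const, rfl⟩, dist_self _⟩
    have h : f y = f x := dist_eq_zero.1 hy
    change f y ∈ s
    rw [h]
    exact hx
  | limit α f β u _ _ _ hlim ih =>
    refine isOpen_iff_forall_mem_open.2 fun x hx => ?_
    refine ⟨⋂ n, u n ⁻¹' {u n x}, fun y hy => ?_, isPSpace_withBaireTopology _ fun n => ih n _,
      mem_iInter.2 fun n => rfl⟩
    have h : (fun n => u n y) = fun n => u n x := funext fun n => mem_iInter.1 hy n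
    have h' : f y = f x := tendsto_nhds_unique (hlim y) (h ▸ hlim x)
    change f y ∈ s
    rw [h']
    exact hx

theorem exists_continuous_zero_subset {F : Set X} (hF : F.Finite) {U : Set X}
    (hU : IsOpen (X := WithBaireTopology X) U) (hFU : F ⊆ U) :
    ∃ φ : X → ℝ, Continuous φ ∧ (∀ x ∈ F, φ x = 0) ∧ ∀ x, φ x = 0 → x ∈ U := by
  induction F, hF using Set.Finite.induction_on with
  | empty => exact ⟨fun _ => 1, continuous_const, by simp, fun x h => absurd h one_ne_zero⟩
  | @insert a F _ _ ih =>
    obtain ⟨φ, hφ, h1, h2⟩ := ih ((subset_insert a F).trans hFU)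
    obtain ⟨_, ⟨ψ, hψ, rfl⟩, haψ, hsub⟩ :=
      (isTopologicalBasis_zeroSets X).isOpen_iff.1 hU a (hFU (mem_insert a F))
    have ha : ψ a = 0 := haψ
    refine ⟨fun x => ψ x * φ x, hψ.mul hφ, ?_, fun x hx => ?_⟩
    · rintro x (rfl | hx)
      · simp [ha]
      · simp [h1 x hx]
    · rcases mul_eq_zero.1 hx with h | h
      · exact hsub h
      · exact h2 x h

theorem IsTychonoffFor.t1Space [Nontrivial Y] [TopologicalSpace.MetrizableSpace Y]
    (hX : IsTychonoffFor X Y) : T1Space (WithBaireTopology X) := by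
  classical
  obtain ⟨a, b, hab⟩ := exists_pair_ne Y
  have key : ∀ x y : X, x ≠ y → ∃ g : X → Y, Continuous g ∧ g x = a ∧ g y = b := by
    intro x y hxy
    obtain ⟨g, hg, hgF, -⟩ := hX ∅ a {x, y} (fun z => if (z : X) = x then a else b) isClosed_empty
      (toFinite _) (disjoint_empty _)
    exact ⟨g, hg, by simpa using hgF ⟨x, by simp⟩, by simpa [hxy.symm] using hgF ⟨y, by simp⟩⟩
  refine t1Space_iff_exists_open.2 fun x y hxy => ?_
  obtain ⟨g, hg, hgx, hgy⟩ := key x y hxy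
  refine ⟨g ⁻¹' {a}, (IsBaireOfClass.continuous g hg).isOpen_preimage _, hgx, fun h => hab ?_⟩
  exact (show g y = a from h).symm.trans hgy

/-- In a `Y`-Tychonoff space, finite sets are separated from the complements of their
neighbourhoods in the Baire topology by two-valued functions of the stable first Baire class. -/
theorem IsTychonoffFor.exists_mem_stableBaireOne [TopologicalSpace.MetrizableSpace Y]
    (hX : IsTychonoffFor X Y) {F U : Set X} (hF : F.Finite)
    (hU : IsOpen (X := WithBaireTopology X) U) (hFU : F ⊆ U) (a b : Y) :
    ∃ f ∈ stableBaireOne X Y, (∀ x ∈ F, f x = a) ∧ (∀ x ∉ U, f x = b) ∧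
      ∀ x, f x = a ∨ f x = b := by
  classical
  let _ := TopologicalSpace.metrizableSpaceMetric Y
  obtain ⟨φ, hφ, hφF, hφU⟩ := exists_continuous_zero_subset hF hU hFU
  have step : ∀ (n : ℕ) (ρ : {ρ : X → ℝ // Continuous ρ ∧ ∀ x ∈ F, ρ x = 0}),
      ∃ g : X → Y, Continuous g ∧ (∀ x ∈ F, g x = a) ∧
        ∀ x, 1 / ((n : ℝ) + 1) ≤ ρ.1 x → g x = b := by
    rintro n ⟨ρ, hρ, hρF⟩
    obtain ⟨g, hg, hgF, hgA⟩ := hX {x | 1 / ((n : ℝ) + 1) ≤ ρ x} b F (fun _ => a)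
      (isClosed_le continuous_const hρ) hF (disjoint_left.2 fun x hx h => by
        rw [mem_ofPred_eq, hρF x hx] at h
        exact absurd h (not_le.2 (by positivity)))
    exact ⟨g, hg, fun x hx => hgF ⟨x, hx⟩, hgA⟩
  choose G hGc hGF hGb using step
  -- With φ alone, the approximations could oscillate at zeros of φ outside F. Adding the distance
  -- to a at each stage records any departure from a: once ρ is positive at x, monotonicity makes
  -- all late approximations equal to b there.
  let ρ : ℕ → {ρ : X → ℝ // Continuous ρ ∧ ∀ x ∈ F, ρ x = 0} := fun n =>
    Nat.rec ⟨fun x => |φ x|, hφ.abs, fun x hx => by simp [hφF x hx]⟩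
      (fun n r => ⟨fun x => r.1 x + dist (G n r x) a,
        r.2.1.add ((hGc n r).dist continuous_const), fun x hx => by
          simp [r.2.2 x hx, hGF n r x hx]⟩) n
  have hρ0 : ∀ x, (ρ 0).1 x = |φ x| := fun _ => rfl
  have hρs : ∀ n x, (ρ (n + 1)).1 x = (ρ n).1 x + dist (G n (ρ n) x) a := fun _ _ => rfl
  have hmono : ∀ x, Monotone fun n => (ρ n).1 x := fun x =>
    monotone_nat_of_le_succ fun n => by
      simp only [hρs]
      exact le_add_of_nonneg_right dist_nonneg
  have hnn : ∀ n x, 0 ≤ (ρ n).1 x := fun n x =>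
    (hρ0 x ▸ abs_nonneg (φ x)).trans (hmono x (Nat.zero_le n))
  refine ⟨fun x => if ∀ n, (ρ n).1 x = 0 then a else b,
    ⟨fun n => G n (ρ n), fun n => hGc n _, fun x => ?_⟩, ?_, ?_, ?_⟩
  · by_cases hx : ∀ n, (ρ n).1 x = 0
    · have h : ∀ n, G n (ρ n) x = a := fun n => by
        have := hρs n x
        rw [hx (n + 1), hx n, zero_add] at this
        exact dist_eq_zero.1 this.symm
      simp [hx, h]
    · have hx' := hx
      push Not at hx'
      obtain ⟨m, hm⟩ := hx'
      have hpos : 0 < (ρ m).1 x := lt_of_le_of_ne (hnn m x) hm.symm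
      obtain ⟨k, hk⟩ := exists_nat_one_div_lt hpos
      refine (finite_Iio (max m k)).subset fun n hn => ?_
      by_contra hlt
      simp only [mem_Iio, not_lt] at hlt
      refine hn (Eq.trans ?_ (if_neg hx).symm)
      refine hGb n _ x (le_trans ?_ (hk.le.trans (hmono x ((le_max_left m k).trans hlt))))
      have : (k : ℝ) ≤ n := by exact_mod_cast (le_max_right m k).trans hlt
      exact one_div_le_one_div_of_le (by positivity) (by linarith)
  · intro x hx
    exact if_pos fun n => (ρ n).2.2 x hx
  · intro x hx
    refine if_neg fun h => hx (hφU x ?_)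
    exact abs_eq_zero.1 (hρ0 x ▸ h 0)
  · intro x
    by_cases hx : ∀ n, (ρ n).1 x = 0
    · exact Or.inl (if_pos hx)
    · exact Or.inr (if_neg hx)

theorem isTychonoffFor_real [T35Space X] : IsTychonoffFor X ℝ := by
  classical
  intro A y₀ F f hA hF hFA
  have key : ∀ x : F, ∃ φ : X → ℝ, Continuous φ ∧ φ x = 1 ∧ ∀ y ∈ A ∪ F \ {(x : X)}, φ y = 0 := by
    intro x
    obtain ⟨φ, hφ, h0, h1⟩ := CompletelyRegularSpace.completely_regular (x : X) (A ∪ F \ {(x : X)})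
      (hA.union (hF.subset sdiff_subset).isClosed)
      (fun h => h.elim (disjoint_left.1 hFA x.2) fun h => h.2 rfl)
    refine ⟨fun y => 1 - φ y, continuous_const.sub (continuous_subtype_val.comp hφ), by simp [h0],
      fun y hy => by simp [h1 hy]⟩
  choose φ hφ h1 h0 using key
  have := hF.fintype
  refine ⟨fun y => y₀ + ∑ x : F, (f x - y₀) * φ x y, ?_, fun x => ?_, fun y hy => ?_⟩
  · exact continuous_const.add (continuous_finsetSum _ fun x _ => continuous_const.mul (hφ x))
  · change y₀ + ∑ z : F, (f z - y₀) * φ z x = f x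
    rw [Finset.sum_eq_single x]
    · simp [h1]
    · intro z _ hz
      rw [h0 z x (Or.inr ⟨x.2, fun h => hz (Subtype.ext h.symm)⟩), mul_zero]
    · simp
  · simp only [add_eq_left]
    exact Finset.sum_eq_zero fun x _ => by rw [h0 x y (Or.inl hy), mul_zero]

end BaireTopology

/-! ### Compactness and transfinite recursion -/

section Preliminaries

theorem exists_isCompact_mem_closure_inter {T : Type*} [TopologicalSpace T] [T2Space T]
    [CompactlyCoherentSpace T] {A : Set T} (hA : ¬ IsClosed A) :
    ∃ K : Set T, IsCompact K ∧ ∃ p ∈ K, p ∈ closure (A ∩ K) ∧ p ∉ A := by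
  obtain ⟨K, hK, hKA⟩ := (compactlyCoherentSpace_iff T).1 inferInstance A hA
  by_contra! h
  refine hKA ?_
  have hcl : IsClosed (A ∩ K) := isClosed_of_closure_subset fun p hp => by
    have hpK : p ∈ K := closure_minimal inter_subset_right hK.isClosed hp
    exact ⟨h K hK p hpK hp, hpK⟩
  convert hcl.preimage (continuous_subtype_val (p := (· ∈ K))) using 1
  ext x
  simp

theorem _root_.MapClusterPt.mem_of_isClosed {ι T : Type*} [TopologicalSpace T] {l : Filter ι}
    {u : ι → T} {q : T} (hq : MapClusterPt q l u) {S : Set T} (hS : IsClosed S)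
    (h : ∀ᶠ i in l, u i ∈ S) : q ∈ S := by
  by_contra hn
  obtain ⟨i, hi, hi'⟩ :=
    ((mapClusterPt_iff_frequently.1 hq _ (hS.isOpen_compl.mem_nhds hn)).and_eventually h).exists
  exact hi hi'

/-- A non-compact metrizable space contains a sequence that meets each compact set in finitely many
terms, and a point outside of this sequence. -/
theorem exists_seq_finite_preimage_isCompact (Y : Type*) [TopologicalSpace Y]
    [TopologicalSpace.MetrizableSpace Y] [NoncompactSpace Y] :
    ∃ (b : Y) (u : ℕ → Y), (∀ n, u n ≠ b) ∧ ∀ C : Set Y, IsCompact C → {n | u n ∈ C}.Finite := by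
  let _ := TopologicalSpace.metrizableSpaceMetric Y
  have hnot : ¬ IsSeqCompact (univ : Set Y) := fun h => noncompact_univ Y h.isCompact
  rw [IsSeqCompact] at hnot
  push Not at hnot
  obtain ⟨u, -, hu⟩ := hnot
  have hfin : ∀ C : Set Y, IsCompact C → {n | u n ∈ C}.Finite := by
    intro C hC
    by_contra hinf
    obtain ⟨a, -, φ, hφ, hlim⟩ := hC.tendsto_subseq' (Nat.frequently_atTop_iff_infinite.2 hinf)
    exact hu a (mem_univ a) φ hφ hlim
  obtain ⟨N, hN⟩ := (hfin {u 0} isCompact_singleton).bddAbove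
  -- N bounds the indices at which the value u 0 occurs, so the shifted tail avoids it.
  refine ⟨u 0, fun n => u (n + (N + 1)), fun n h => ?_, fun C hC => ?_⟩
  · have : n + (N + 1) ≤ N := hN h
    omega
  · exact (hfin C hC).preimage (f := fun n => n + (N + 1)) (add_left_injective _).injOn

theorem exists_uncountable_linearOrder_countable_Iio :
    ∃ (I : Type) (_ : LinearOrder I), WellFoundedLT I ∧ Uncountable I ∧
      ∀ i : I, (Iio i).Countable := by
  refine ⟨(Cardinal.aleph 1).ord.ToType, inferInstance, inferInstance, ?_, fun i => ?_⟩
  · rw [← Cardinal.aleph0_lt_mk_iff]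
    simp
  · rw [← Cardinal.le_aleph0_iff_set_countable, ← Order.lt_succ_iff, Cardinal.succ_aleph0]
    exact (Cardinal.mk_Iio_lt i (by simp)).trans_eq (by simp)

theorem exists_transfinite_sequences {I V W : Type*} [LinearOrder I] [WellFoundedLT I]
    (v : Set W → V) (w : Set V → W) :
    ∃ (x : I → V) (f : I → W), ∀ i, x i = v (f '' Iio i) ∧ f i = w (x '' Iic i) := by
  let step : ∀ i : I, (∀ j, j < i → V × W) → V × W := fun i r =>
    let x := v (range fun j : Iio i => (r j j.2).2)
    (x, w (insert x (range fun j : Iio i => (r j j.2).1)))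
  let r : I → V × W := IsWellFounded.fix (· < ·) step
  have hr : ∀ i, r i = step i fun j _ => r j := fun i => IsWellFounded.fix_eq (· < ·) step i
  have h1 : ∀ i, (r i).1 = v ((fun j => (r j).2) '' Iio i) := fun i => by
    rw [hr i, image_eq_range]
  refine ⟨fun i => (r i).1, fun i => (r i).2, fun i => ⟨h1 i, ?_⟩⟩
  have h2 : (r i).2 = w (insert (v (range fun j : Iio i => (r j).2))
      (range fun j : Iio i => (r j).1)) := by rw [hr i]
  refine h2.trans ?_
  rw [← Iio_insert, image_insert_eq, h1 i, image_eq_range, image_eq_range]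

end Preliminaries

/-! ### Lindelöfness from tightness or the `k`-property -/

section FunctionSpaces

variable {Z Y : Type*} {H : Set (Z → Y)}

theorem mem_closure_of_forall_finite [TopologicalSpace Y] {S : Set H} {f : H}
    (h : ∀ F : Set Z, F.Finite → ∃ g ∈ S, ∀ x ∈ F, (g : Z → Y) x = (f : Z → Y) x) :
    f ∈ closure S := by
  rw [closure_subtype, mem_closure_iff]
  intro O hO hfO
  obtain ⟨I, u, hu, hsub⟩ := isOpen_pi_iff.1 hO _ hfO
  obtain ⟨g, hg, hgf⟩ := h I I.finite_toSet
  exact ⟨g, hsub fun x hx => hgf x hx ▸ (hu x hx).2, mem_image_of_mem _ hg⟩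

theorem continuous_eval_subtype [TopologicalSpace Y] (x : Z) :
    Continuous fun g : H => (g : Z → Y) x :=
  (continuous_apply x).comp continuous_subtype_val

theorem apply_mem_of_mem_closure [TopologicalSpace Y] {T : Set Y} (hT : IsClosed T) {S : Set H}
    {x : Z} (hS : ∀ g ∈ S, (g : Z → Y) x ∈ T) {f : H} (hf : f ∈ closure S) :
    (f : Z → Y) x ∈ T :=
  closure_minimal hS (hT.preimage (continuous_eval_subtype x)) hf

/-- Functions with values in a fixed finite set approximate a point of their closure exactly on
finite sets. -/
theorem exists_eqOn_of_mem_closure [TopologicalSpace Y] [T1Space Y] {T : Set Y} (hT : T.Finite)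
    {S : Set H} (hS : ∀ g ∈ S, ∀ x, (g : Z → Y) x ∈ T) {f : H} (hf : f ∈ closure S) {F : Set Z}
    (hF : F.Finite) : ∃ g ∈ S, ∀ x ∈ F, (g : Z → Y) x = (f : Z → Y) x := by
  have h : ∀ x ∈ F, ∀ᶠ g : H in 𝓝 f, (g : Z → Y) x ∈ (T \ {(f : Z → Y) x})ᶜ := fun x _ =>
    (continuous_eval_subtype x).continuousAt.eventually_mem
      ((hT.subset sdiff_subset).isClosed.isOpen_compl.mem_nhds fun h => h.2 rfl)
  obtain ⟨g, hg, hgS⟩ := mem_closure_iff_nhds.1 hf _ (hF.eventually_all.2 h)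
  refine ⟨g, hgS, fun x hx => ?_⟩
  by_contra hne
  exact hg x hx ⟨hS g hgS x, hne⟩

/-- The functions in `H` with values `a` and `b` which take the value `a` only on a set that is
covered by countably many members of the family `U`. -/
def countablyCovered (H : Set (Z → Y)) {ι : Type*} (U : ι → Set Z) (a b : Y) : Set H :=
  {f | (∀ x, (f : Z → Y) x ∈ ({a, b} : Set Y)) ∧
    ∃ t : Set ι, t.Countable ∧ ∀ x, (f : Z → Y) x = a → x ∈ ⋃ i ∈ t, U i}

/-- Approximation by two-valued functions is exact at each point, so the a-level set of f lies in
the union of those of the members of C. -/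
theorem mem_countablyCovered_of_mem_closure [TopologicalSpace Y] [T1Space Y] {ι : Type*}
    {U : ι → Set Z} {a b : Y} {C : Set H} (hC : C.Countable) (hCU : C ⊆ countablyCovered H U a b)
    {f : H} (hf : f ∈ closure C) : f ∈ countablyCovered H U a b := by
  choose! t ht hcov using fun g (hg : g ∈ C) => (hCU hg).2
  refine ⟨fun x => apply_mem_of_mem_closure (toFinite _).isClosed (fun g hg => (hCU hg).1 x) hf,
    ⋃ g ∈ C, t g, hC.biUnion ht, fun x hx => ?_⟩
  obtain ⟨g, hg, hgf⟩ := exists_eqOn_of_mem_closure (toFinite _) (fun g hg => (hCU hg).1) hf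
    (finite_singleton x)
  obtain ⟨i, hi, hxi⟩ := mem_iUnion₂.1 (hcov g hg x ((hgf x rfl).trans hx))
  exact mem_iUnion₂.2 ⟨i, mem_iUnion₂.2 ⟨g, hg, hi⟩, hxi⟩

/-- Members agreeing with p on longer and longer finite parts of E have a cluster point in K; being
in the closure of a countable set, it remains countably covered. -/
theorem exists_mem_countablyCovered_eqOn [TopologicalSpace Y] [T1Space Y] {ι : Type*}
    {U : ι → Set Z} {a b : Y} {K : Set H} (hK : IsCompact K) {p : H}
    (hp : p ∈ closure (countablyCovered H U a b ∩ K)) {E : Set Z} (hE : E.Countable)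
    (hEp : ∀ x ∈ E, (p : Z → Y) x = a) :
    ∃ f ∈ countablyCovered H U a b ∩ K, ∀ x ∈ E, (f : Z → Y) x = a := by
  rcases E.eq_empty_or_nonempty with rfl | hne
  · obtain ⟨f, hf⟩ := closure_nonempty_iff.1 ⟨p, hp⟩
    exact ⟨f, hf, by simp⟩
  obtain ⟨e, rfl⟩ := hE.exists_eq_range hne
  choose g hg hgp using fun n : ℕ => exists_eqOn_of_mem_closure (toFinite ({a, b} : Set Y))
    (fun g hg => hg.1.1) hp ((finite_Iic n).image e)
  obtain ⟨q, hqK, hq⟩ := hK.exists_mapClusterPt (f := atTop) (u := g)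
    (tendsto_principal.2 (Eventually.of_forall fun n => (hg n).2))
  refine ⟨q, ⟨mem_countablyCovered_of_mem_closure (countable_range g) ?_ ?_, hqK⟩, ?_⟩
  · rintro _ ⟨n, rfl⟩
    exact (hg n).1
  · exact hq.mem_of_isClosed isClosed_closure
      (Eventually.of_forall fun n => subset_closure (mem_range_self n))
  · rintro _ ⟨i, rfl⟩
    refine hq.mem_of_isClosed (isClosed_singleton.preimage (continuous_eval_subtype (e i))) ?_
    filter_upwards [eventually_ge_atTop i] with n hn
    exact (hgp n _ (mem_image_of_mem e hn)).trans (hEp _ (mem_range_self i))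

variable [TopologicalSpace Z]

/-- The functions in `H` separate finite sets from the complements of their neighbourhoods, by
functions with two prescribed values. -/
def SeparatesFinite (H : Set (Z → Y)) : Prop :=
  ∀ F U : Set Z, F.Finite → IsOpen U → F ⊆ U → ∀ a b : Y,
    ∃ f ∈ H, (∀ x ∈ F, f x = a) ∧ (∀ x ∉ U, f x = b) ∧ ∀ x, f x = a ∨ f x = b

theorem SeparatesFinite.const_mem (hH : SeparatesFinite H) (a : Y) : (fun _ => a) ∈ H := by
  obtain ⟨f, hf, -, -, h⟩ := hH ∅ ∅ finite_empty isOpen_empty le_rfl a a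
  rwa [funext fun x => (h x).elim id id] at hf

/-- If `H` is a `k`-space, then every locally countable subset of the `P`-space `Z` is countable. -/
theorem SeparatesFinite.countable_of_locally_countable [TopologicalSpace Y]
    [TopologicalSpace.MetrizableSpace Y] [NoncompactSpace Y] [T1Space Z] (hP : IsPSpace Z)
    (hH : SeparatesFinite H) [CompactlyCoherentSpace H] {D : Set Z}
    (hD : ∀ x, ∃ U, IsOpen U ∧ x ∈ U ∧ (U ∩ D).Countable) : D.Countable := by
  classical
  by_contra hunc
  obtain ⟨b, u, hub, hu⟩ := exists_seq_finite_preimage_isCompact Y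
  -- Each B n is closed, and the constant b is in the closure of their union but not in the union. A
  -- compact K bounds the indices n with f x = u n at each x; some bound m serves infinitely many x
  -- in D. For n > m a member of B n in K would equal b at all of them, so only finitely many B n
  -- matter on K.
  let B : ℕ → Set H := fun n => {f | (∀ x, (f : Z → Y) x ∈ ({b, u n} : Set Y)) ∧
    ∀ F : Finset Z, (F : Set Z) ⊆ D → (∀ x ∈ F, (f : Z → Y) x = b) → F.card ≤ n}
  have hBclosed : ∀ n, IsClosed (B n) := by
    refine fun n => isClosed_of_closure_subset fun f hf => ⟨fun x => ?_, fun F hFD hFb => ?_⟩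
    · exact apply_mem_of_mem_closure (toFinite _).isClosed (fun g hg => hg.1 x) hf
    · obtain ⟨g, hg, hgf⟩ :=
        exists_eqOn_of_mem_closure (toFinite _) (fun g hg => hg.1) hf F.finite_toSet
      exact hg.2 F hFD fun x hx => (hgf x hx).trans (hFb x hx)
  have hnot : ¬ IsClosed (⋃ n, B n) := by
    intro hcl
    have hmem : (⟨_, hH.const_mem b⟩ : H) ∈ ⋃ n, B n := by
      refine hcl.closure_subset (mem_closure_of_forall_finite fun F hF => ?_)
      obtain ⟨U, hU, hFU, hUD⟩ := hP.exists_isOpen_inter_subset hD hF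
      obtain ⟨f, hf, hfF, hfU, hfv⟩ := hH F U hF hU hFU b (u hF.toFinset.card)
      refine ⟨⟨f, hf⟩, mem_iUnion.2 ⟨hF.toFinset.card, hfv, fun G hGD hGb => ?_⟩, hfF⟩
      refine Finset.card_le_card fun x hx => hF.mem_toFinset.2 (hUD ⟨?_, hGD hx⟩)
      by_contra hxU
      exact hub _ ((hfU x hxU).symm.trans (hGb x hx))
    obtain ⟨n, hn⟩ := mem_iUnion.1 hmem
    have hinf : D.Infinite := fun h => hunc h.countable
    obtain ⟨G, hGD, hG⟩ := hinf.exists_subset_card_eq (n + 1)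
    have := hn.2 G hGD fun _ _ => rfl
    omega
  obtain ⟨K, hK, p, -, hpcl, hpB⟩ := exists_isCompact_mem_closure_inter hnot
  have hN : ∀ x : Z, ∃ N : ℕ, ∀ f ∈ K, ∀ n, (f : Z → Y) x = u n → n ≤ N := fun x => by
    obtain ⟨N, hN⟩ := (hu _ (hK.image (continuous_eval_subtype x))).bddAbove
    exact ⟨N, fun f hf n hn => hN ⟨f, hf, hn⟩⟩
  choose N hN using hN
  obtain ⟨m, hm⟩ : ∃ m, {x ∈ D | N x ≤ m}.Infinite := by
    by_contra! h
    refine hunc ((countable_iUnion fun m => (h m).countable).mono fun x hx => ?_)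
    exact mem_iUnion.2 ⟨N x, hx, le_rfl⟩
  have hsub : (⋃ n, B n) ∩ K ⊆ ⋃ n ∈ Iic m, B n := by
    rintro f ⟨hfB, hfK⟩
    obtain ⟨n, hn⟩ := mem_iUnion.1 hfB
    refine mem_iUnion₂.2 ⟨n, ?_, hn⟩
    by_contra hnm
    obtain ⟨G, hGD, hG⟩ := hm.exists_subset_card_eq (n + 1)
    have := hn.2 G (fun x hx => (hGD hx).1) fun x hx => (hn.1 x).resolve_right fun h =>
      hnm ((hN x f hfK n h).trans (hGD hx).2)
    omega
  obtain ⟨n, -, hn⟩ := mem_iUnion₂.1 (closure_minimal hsub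
    ((finite_Iic m).isClosed_biUnion fun n _ => hBclosed n) hpcl)
  exact hpB (mem_iUnion.2 ⟨n, hn⟩)

theorem SeparatesFinite.const_mem_closure_countablyCovered [TopologicalSpace Y]
    (hH : SeparatesFinite H) {ι : Type*} {U : ι → Set Z} (hU : ∀ i, IsOpen (U i))
    (hcov : univ ⊆ ⋃ i, U i) {a b : Y} (hab : a ≠ b) :
    (⟨_, hH.const_mem a⟩ : H) ∈ closure (countablyCovered H U a b) := by
  refine mem_closure_of_forall_finite fun F hF => ?_
  choose i hi using fun x => mem_iUnion.1 (hcov (mem_univ x))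
  obtain ⟨f, hf, hfF, hfU, hfv⟩ := hH F (⋃ j ∈ i '' F, U j) hF
    (isOpen_biUnion fun j _ => hU j)
    (fun x hx => mem_iUnion₂.2 ⟨i x, mem_image_of_mem i hx, hi x⟩) a b
  refine ⟨⟨f, hf⟩, ⟨hfv, i '' F, (hF.image i).countable, fun x hx => ?_⟩, hfF⟩
  by_contra hxU
  exact hab (hx.symm.trans (hfU x hxU))

theorem SeparatesFinite.lindelofSpace_of_hasCountableTightness [TopologicalSpace Y] [T1Space Y]
    [Nontrivial Y] (hH : SeparatesFinite H) (hT : HasCountableTightness H) : LindelofSpace Z := by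
  obtain ⟨a, b, hab⟩ := exists_pair_ne Y
  refine ⟨isLindelof_of_countable_subcover fun U hU hcov => ?_⟩
  obtain ⟨C, hCU, hC, hcl⟩ := hT _ _ (hH.const_mem_closure_countablyCovered hU hcov hab)
  obtain ⟨-, t, ht, htcov⟩ := mem_countablyCovered_of_mem_closure hC hCU hcl
  exact ⟨t, ht, fun x _ => htcov x rfl⟩

theorem SeparatesFinite.lindelofSpace_of_compactlyCoherentSpace [TopologicalSpace Y]
    [TopologicalSpace.MetrizableSpace Y] [NoncompactSpace Y] [Nontrivial Y] [T1Space Z]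
    (hP : IsPSpace Z) (hH : SeparatesFinite H)
    (hloc : ∀ f ∈ H, ∀ s : Set Y, IsOpen (f ⁻¹' s)) (hk : CompactlyCoherentSpace H) :
    LindelofSpace Z := by
  obtain ⟨a, b, hab⟩ := exists_pair_ne Y
  refine ⟨isLindelof_of_countable_subcover fun {ι} U hU hcov => ?_⟩
  by_contra! hno
  have hnot : ¬ IsClosed (countablyCovered H U a b) := fun hcl => by
    obtain ⟨-, t, ht, htcov⟩ :=
      hcl.closure_subset (hH.const_mem_closure_countablyCovered hU hcov hab)
    exact hno t ht fun x _ => htcov x rfl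
  obtain ⟨K, hK, p, -, hpcl, hpA⟩ := exists_isCompact_mem_closure_inter hnot
  have hpv : ∀ x, (p : Z → Y) x ∈ ({a, b} : Set Y) := fun x =>
    apply_mem_of_mem_closure (toFinite _).isClosed (fun g hg => hg.1.1 x) hpcl
  -- Otherwise the a-level sets of countably many members would cover that of p, making p countably
  -- covered. Countability is a premise inside the existential so that the choice function is total,
  -- as the recursion needs.
  have hv : ∀ S : Set ↥(countablyCovered H U a b ∩ K), ∃ x : {x // (p : Z → Y) x = a},
      S.Countable → ∀ f ∈ S, (f.1 : Z → Y) x ≠ a := by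
    intro S
    by_contra! h
    have hS : S.Countable := by
      by_contra hS
      refine hpA ⟨hpv, ∅, countable_empty, fun x hx => absurd (h ⟨x, hx⟩).1 hS⟩
    choose t ht htcov using fun f : ↥(countablyCovered H U a b ∩ K) => f.2.1.2
    refine hpA ⟨hpv, ⋃ f ∈ S, t f, hS.biUnion fun f _ => ht f, fun x hx => ?_⟩
    obtain ⟨f, hf, hfx⟩ := (h ⟨x, hx⟩).2
    obtain ⟨i, hi, hxi⟩ := mem_iUnion₂.1 (htcov f x hfx)
    exact mem_iUnion₂.2 ⟨i, mem_iUnion₂.2 ⟨f, hf, hi⟩, hxi⟩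
  have hw : ∀ E : Set {x // (p : Z → Y) x = a}, ∃ f : ↥(countablyCovered H U a b ∩ K),
      E.Countable → ∀ x ∈ E, (f.1 : Z → Y) x = a := by
    intro E
    by_cases hE : E.Countable
    · obtain ⟨f, hf, hfE⟩ := exists_mem_countablyCovered_eqOn hK hpcl
        (hE.image Subtype.val) (by rintro _ ⟨x, -, rfl⟩; exact x.2)
      exact ⟨⟨f, hf⟩, fun _ x hx => hfE x (mem_image_of_mem _ hx)⟩
    · obtain ⟨f, hf⟩ := closure_nonempty_iff.1 ⟨p, hpcl⟩
      exact ⟨⟨f, hf⟩, fun h => absurd h hE⟩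
  choose v hv using hv
  choose w hw using hw
  obtain ⟨I, _, _, _, hI⟩ := exists_uncountable_linearOrder_countable_Iio
  have hI' : ∀ i : I, (Iic i).Countable := fun i => by
    rw [← Iio_insert]
    exact (hI i).insert i
  obtain ⟨x, f, hxf⟩ := exists_transfinite_sequences (I := I) v w
  have hlt : ∀ i j, i < j → ((f i).1 : Z → Y) (x j) ≠ a := fun i j hij => by
    rw [(hxf j).1]
    exact hv _ ((hI j).image f) _ (mem_image_of_mem f hij)
  have hle : ∀ i j, i ≤ j → ((f j).1 : Z → Y) (x i) = a := fun i j hij => by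
    rw [(hxf j).2]
    exact hw _ ((hI' j).image x) _ (mem_image_of_mem x hij)
  have hinj : Function.Injective fun i => (x i : Z) := by
    intro i j hij
    by_contra hne
    have hij' : (x i : Z) = x j := hij
    rcases lt_or_gt_of_ne hne with h | h
    · exact hlt i j h (hij' ▸ hle i i le_rfl)
    · exact hlt j i h (hij' ▸ hle j j le_rfl)
  obtain ⟨q, -, hq⟩ := hK.exists_mapClusterPt (f := atTop) (u := fun i : I => (f i).1)
    (tendsto_principal.2 (Eventually.of_forall fun i => (f i).2.2))
  have hqx : ∀ i, (q : Z → Y) (x i) = a := fun i => by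
    refine hq.mem_of_isClosed
      (isClosed_singleton.preimage (continuous_eval_subtype (x i : Z))) ?_
    filter_upwards [eventually_ge_atTop i] with j hj
    exact hle i j hj
  -- Where q is a, some f j is a nearby, and its a-level set contains x i only for i ≤ j. Elsewhere
  -- the set where q differs from a contains no x i.
  have hcount : (range fun i => (x i : Z)).Countable := by
    refine hH.countable_of_locally_countable hP fun z => ?_
    by_cases hz : (q : Z → Y) z = a
    · have hN : {g : H | (g : Z → Y) z ∈ ({b}ᶜ : Set Y)} ∈ 𝓝 q :=
        (continuous_eval_subtype z).continuousAt.eventually_mem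
          (isOpen_compl_singleton.mem_nhds (by simpa [hz] using hab))
      obtain ⟨j, hj⟩ := (mapClusterPt_iff_frequently.1 hq _ hN).exists
      refine ⟨((f j).1 : Z → Y) ⁻¹' {a}, hloc _ (f j).1.2 _, ((f j).2.1.1 z).resolve_right hj,
        ((hI' j).image fun i => (x i : Z)).mono ?_⟩
      rintro _ ⟨hxi, i, rfl⟩
      exact ⟨i, not_lt.1 fun h => hlt j i h hxi, rfl⟩
    · refine ⟨(q : Z → Y) ⁻¹' {a}ᶜ, hloc _ q.2 _, hz, ?_⟩
      convert countable_empty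
      refine eq_empty_of_forall_notMem ?_
      rintro _ ⟨hxi, i, rfl⟩
      exact hxi (hqx i)
  have hI'' := hcount.preimage_of_injOn hinj.injOn
  rw [preimage_range] at hI''
  exact not_countable (α := I) (countable_univ_iff.1 hI'')

end FunctionSpaces

/-! ### The equivalences -/

section Main

theorem HasCountableTightness.of_frechetUrysohnSpace {T : Type*} [TopologicalSpace T]
    [FrechetUrysohnSpace T] : HasCountableTightness T := by
  intro A x hx
  obtain ⟨u, hu, hlim⟩ := mem_closure_iff_seq_limit.1 hx
  exact ⟨range u, range_subset_iff.2 hu, countable_range u,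
    mem_closure_of_tendsto hlim (Eventually.of_forall mem_range_self)⟩

theorem IsTychonoffFor.tfae {X Y : Type*} [TopologicalSpace X] [TopologicalSpace Y]
    [TopologicalSpace.MetrizableSpace Y] [NoncompactSpace Y] (hX : IsTychonoffFor X Y)
    {H : Set (X → Y)} (hstable : stableBaireOne X Y ⊆ H) (hbaire : H ⊆ baireFunctions X Y) :
    List.TFAE [
      FrechetUrysohnSpace H,
      SequentialSpace H,
      CompactlyCoherentSpace H,
      HasCountableTightness H,
      HasPropertyGamma (WithBaireTopology X)] := by
  have hnt : Nontrivial Y := by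
    obtain ⟨b, u, hub, -⟩ := exists_seq_finite_preimage_isCompact Y
    exact ⟨u 0, b, hub 0⟩
  have := hX.t1Space
  have hP : IsPSpace (WithBaireTopology X) := isPSpace_withBaireTopology
  have hloc : ∀ f ∈ H, ∀ s : Set Y, IsOpen (X := WithBaireTopology X) (f ⁻¹' s) :=
    fun f hf s => by
      obtain ⟨α, -, hα⟩ := hbaire hf
      exact hα.isOpen_preimage s
  have hsep : SeparatesFinite (Z := WithBaireTopology X) H := fun F U hF hU hFU a b => by
    obtain ⟨f, hf, h⟩ := hX.exists_mem_stableBaireOne hF hU hFU a b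
    exact ⟨f, hstable hf, h⟩
  tfae_have 1 → 2 := fun _ => inferInstance
  tfae_have 2 → 3 := fun _ => inferInstance
  tfae_have 1 → 4 := fun _ => HasCountableTightness.of_frechetUrysohnSpace
  tfae_have 3 → 5 := fun h => by
    have := hsep.lindelofSpace_of_compactlyCoherentSpace hP hloc h
    exact hP.hasPropertyGamma
  tfae_have 4 → 5 := fun h => by
    have := hsep.lindelofSpace_of_hasCountableTightness h
    exact hP.hasPropertyGamma
  tfae_have 5 → 1 := fun h => h.frechetUrysohnSpace hloc
  tfae_finish

end Main

end BaireSpaces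

open BaireSpaces in
theorem theoremt :
    (∀ (X Y : Type*) [TopologicalSpace X] [TopologicalSpace Y]
      [TopologicalSpace.MetrizableSpace Y] [NoncompactSpace Y],
      IsTychonoffFor X Y →
      ∀ H : Set (X → Y), stableBaireOne X Y ⊆ H → H ⊆ baireFunctions X Y →
        List.TFAE [
          FrechetUrysohnSpace H,
          SequentialSpace H,
          CompactlyCoherentSpace H,
          HasCountableTightness H,
          HasPropertyGamma (WithBaireTopology X)]) ∧
    (∀ (X : Type*) [TopologicalSpace X] [T35Space X],
      ∀ H : Set (X → ℝ), stableBaireOne X ℝ ⊆ H → H ⊆ baireFunctions X ℝ →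
        List.TFAE [
          FrechetUrysohnSpace H,
          SequentialSpace H,
          CompactlyCoherentSpace H,
          HasCountableTightness H,
          HasPropertyGamma (WithBaireTopology X)]) := by
  exact ⟨fun X Y _ _ _ _ hX H hstable hbaire => hX.tfae hstable hbaire,
    fun X _ _ H hstable hbaire => isTychonoffFor_real.tfae hstable hbaire⟩
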